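/- Let $K/\mathbf Q$ be a finite Galois extension with ring of integers $\mathcal O_K$. For each prime number $p$ let $e_p$ be the ramification index and $f_p$ the residue class degree of the primes of $\mathcal O_K$ above $p$, and put $q_p=p^{f_p}$. Assume that $K/\mathbf Q$ is tamely ramified, i.e. $p\nmid e_p$ for every prime $p$. Let $$\mathrm{Int}_{\mathbf Q}(\mathcal O_K)=\{f\in\mathbf Q[X] : f(\mathcal O_K)\subseteq\mathcal O_K\},\qquad w_q(n)=\sum_{j\ge 1}\left\lfloor \frac{n}{q^j}\right\rfloor,\qquad \omega_p(n)=\left\lfloor\frac{w_{q_p}(n)}{e_p}\right\rfloor,$$ and let the $n$-th characteristic ideal $\mathfrak I_n(\mathrm{Int}_{\mathbf Q}(\mathcal O_K))\subseteq\mathbf Q$ be the $\mathbf Z$-module generated by the leading coefficients of all $f\in\mathrm{Int}_{\mathbf Q}(\mathcal O_K)$ of degree exactly $n$. (1) For every $n\ge 0$, $$\mathfrak I_n(\mathrm{Int}_{\mathbf Q}(\mathcal O_K))=\Bigl(\prod_p p^{-\omega_p(n)}\Bigr)$$ as fractional ideals of $\mathbf Z$, the product being over all prime numbers $p$ (all but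 finitely many factors are $1$). (2) Let $\{f_n\}_{n\ge 0}$ be a regular basis of $\mathrm{Int}_{\mathbf Q}(\mathcal O_K)$, that is, a $\mathbf Z$-basis with $\deg f_n=n$ for every $n\ge 0$. Then for every $n\ge 0$ there are a monic polynomial $g_n\in\mathbf Z[X]$ and a sign $\varepsilon_n\in\{1,-1\}$ such that $$f_n(X)=\varepsilon_n\,\frac{g_n(X)}{\prod_p p^{\omega_p(n)}}.$$ -/

import Mathlib

open Polynomial
open scoped NumberField nonZeroDivisors

noncomputable section

/-- The ring `Int_ℚ(𝓞 K)` of all `f ∈ ℚ[X]` with `f(𝓞 K) ⊆ 𝓞 K`, as a `ℤ`-subalgebra of `ℚ[X]`. -/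
def IntQ (K : Type*) [Field K] [NumberField K] : Subalgebra ℤ ℚ[X] where
  carrier := {f | ∀ a : 𝓞 K, ∃ b : 𝓞 K, aeval (a : K) f = (b : K)}
  mul_mem' {f g} hf hg a := by
    obtain ⟨b, hb⟩ := hf a
    obtain ⟨c, hc⟩ := hg a
    exact ⟨b * c, by simp [hb, hc]⟩
  add_mem' {f g} hf hg a := by
    obtain ⟨b, hb⟩ := hf a
    obtain ⟨c, hc⟩ := hg a
    exact ⟨b + c, by simp [hb, hc]⟩
  algebraMap_mem' m a := ⟨(m : 𝓞 K), by simp⟩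

/-- The `n`-th characteristic ideal of `Int_ℚ(𝓞 K)`: the `ℤ`-submodule of `ℚ` generated by the
leading coefficients of the elements of `Int_ℚ(𝓞 K)` of degree exactly `n`. -/
def charIdeal (K : Type*) [Field K] [NumberField K] (n : ℕ) : Submodule ℤ ℚ :=
  Submodule.span ℤ {c | ∃ f ∈ IntQ K, f.degree = (n : WithBot ℕ) ∧ f.leadingCoeff = c}

/-- A regular basis of `Int_ℚ(𝓞 K)`: a sequence of polynomials that is a `ℤ`-basis of
`Int_ℚ(𝓞 K)` and whose `n`-th term has degree `n` for every `n ≥ 0`. -/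
structure IsRegularBasis (K : Type*) [Field K] [NumberField K] (f : ℕ → ℚ[X]) : Prop where
  linearIndependent : LinearIndependent ℤ f
  span_eq : Submodule.span ℤ (Set.range f) = Subalgebra.toSubmodule (IntQ K)
  degree_eq : ∀ n : ℕ, (f n).degree = (n : WithBot ℕ)

/-- The ramification index `e_p` of the prime `p` in the Galois extension `K / ℚ`. -/
def ramIdx (K : Type*) [Field K] [NumberField K] (p : ℕ) : ℕ :=
  (Ideal.span {(p : ℤ)}).ramificationIdxIn (𝓞 K)

/-- The cardinality `q_p = p ^ f_p` of the residue fields above `p` in the Galois extension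
`K / ℚ`, where `f_p` is the residue class degree of `p`. -/
def resCard (K : Type*) [Field K] [NumberField K] (p : ℕ) : ℕ :=
  p ^ (Ideal.span {(p : ℤ)}).inertiaDegIn (𝓞 K)

/-- `K / ℚ` is tamely ramified: `p ∤ e_p` for every prime number `p`. -/
def IsTame (K : Type*) [Field K] [NumberField K] : Prop :=
  ∀ p : ℕ, p.Prime → ¬ p ∣ ramIdx K p

/-- `w_q(n) = ∑_{j ≥ 1} ⌊n / q ^ j⌋`; for `q ≥ 2` only finitely many terms are nonzero. -/
def wSum (q n : ℕ) : ℕ := ∑ᶠ j : ℕ, n / q ^ (j + 1)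

/-- `ω_p(n) = ⌊w_{q_p}(n) / e_p⌋`. -/
def omegaExp (K : Type*) [Field K] [NumberField K] (p n : ℕ) : ℕ :=
  wSum (resCard K p) n / ramIdx K p

end

/-!
Fix a prime number `p`, and write `e` and `q` for `e_p` and `q_p`.

**Denominators are bounded.** At a prime `P` of `𝓞 K` above `p`, with residue field of cardinality
`q`, there is a sequence `a` whose terms are congruent modulo `P ^ j` exactly when their indices are
congruent modulo `q ^ j`. The denominators in Lagrange interpolation at `a 0, …, a n` have `P`-adic
valuation at most `w_q(n)`, hence so has the denominator of the leading coefficient of any `f` of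
degree `n` with `f(𝓞 K) ⊆ 𝓞 K`. If that coefficient is rational, `p` divides its denominator at most
`⌊w_q(n) / e⌋ = ω_p(n)` times (`den_leadingCoeff_dvd`).

**The bound is attained.** The monic polynomial `g = ∏_{i < n} (X - a i)` takes values in
`P ^ w_q(n)`, but its coefficients lie in `𝓞 K`. Tameness supplies `c` in `𝓞 K` with trace prime
to `p`: modulo `P` the trace is `e` times a sum of distinct characters, which is not zero by Dedekind's
independence of characters. Moreover `c` can be taken highly divisible by the primes above `p` other
than `P`. The Galois trace of `c * g` is then a polynomial over `ℤ` of degree `n` whose leading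
coefficient is prime to `p` and whose values are divisible by every `P' ^ w_q(n)` with `P'` above
`p`, so by `p ^ ω_p(n)` (`exists_poly_pow_dvd_aeval`). The local polynomials generate a monic
global one with values divisible by `D_n = ∏_p p ^ ω_p(n)` (`exists_monic_forall_dvd_aeval`).

Together these give the characteristic ideals (`charIdeal_eq_span`) and a regular basis `g_n / D_n`
with `g_n` monic over `ℤ`. Since `D_k ∣ D_n` for `k ≤ n`, every element of degree at most `n` has
its coefficients in `D_n⁻¹ ℤ` (`exists_map_eq_commonDenom_mul`), and comparison of leading
coefficients shows that the `n`-th term of any other regular basis has leading coefficient `± 1 / D_n`.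
-/

/-! ### Residue sequences in Dedekind domains -/

theorem wSum_eq_sum {q n N : ℕ} (hq : 2 ≤ q) (hN : n ≤ N) :
    wSum q n = ∑ j ∈ Finset.range N, n / q ^ (j + 1) := by
  refine finsum_eq_sum_of_support_subset _ fun j hj => ?_
  simp only [Function.mem_support, ne_eq, Nat.div_eq_zero_iff, not_or, not_lt] at hj
  have h : j + 1 < q ^ (j + 1) := Nat.lt_pow_self hq
  simp only [Finset.coe_range, Set.mem_Iio]
  omega

theorem wSum_mono {q : ℕ} (hq : 2 ≤ q) : Monotone (wSum q) := by
  intro m n h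
  rw [wSum_eq_sum hq h, wSum_eq_sum hq le_rfl]
  exact Finset.sum_le_sum fun j _ => Nat.div_le_div_right h

theorem wSum_eq_zero {q n : ℕ} (hq : 2 ≤ q) (h : n < q) : wSum q n = 0 := by
  rw [wSum_eq_sum hq le_rfl]
  refine Finset.sum_eq_zero fun j _ => Nat.div_eq_of_lt (h.trans_le ?_)
  exact Nat.le_self_pow (by omega) q

/-- Congruence modulo `q ^ (j + 1)` compares the last base-`q` digit, then the remaining digits
modulo `q ^ j`. -/
theorem Nat.modEq_pow_succ_iff {q : ℕ} (hq : 0 < q) (j i i' : ℕ) :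
    i ≡ i' [MOD q ^ (j + 1)] ↔ i ≡ i' [MOD q] ∧ i / q ≡ i' / q [MOD q ^ j] := by
  simp only [Nat.ModEq, pow_succ', Nat.mod_mul]
  constructor
  · intro h
    have h1 := congrArg (· % q) h
    simp only [Nat.add_mul_mod_self_left, Nat.mod_mod] at h1
    rw [h1] at h
    exact ⟨h1, Nat.eq_of_mul_eq_mul_left hq (Nat.add_left_cancel h)⟩
  · rintro ⟨h1, h2⟩
    rw [h1, h2]

theorem WithZero.prod_exp_neg_natCast {ι : Type*} (s : Finset ι) (f : ι → ℕ) :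
    ∏ i ∈ s, WithZero.exp (-(f i : ℤ)) = WithZero.exp (-((∑ i ∈ s, f i : ℕ) : ℤ)) := by
  classical
  induction s using Finset.induction_on with
  | empty => simp
  | insert i s hi ih =>
    rw [Finset.prod_insert hi, Finset.sum_insert hi, ih, ← WithZero.exp_add, Nat.cast_add, neg_add]

namespace IsDedekindDomain.HeightOneSpectrum

open WithZero

variable {R : Type*} [CommRing R] [IsDedekindDomain R] (v : HeightOneSpectrum R)

/-- A sequence such that, for every `j`, any `q ^ j` consecutive terms represent each class modulo
`v ^ j` exactly once, where `q` is the cardinality of the residue field of `v`. It is stated as: two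
terms are congruent modulo `v ^ j` exactly when their indices are congruent modulo `q ^ j`. -/
def IsResidueSequence (a : ℕ → R) : Prop :=
  ∀ j i i' : ℕ, a i - a i' ∈ v.asIdeal ^ j ↔ i ≡ i' [MOD Nat.card (R ⧸ v.asIdeal) ^ j]

omit [IsDedekindDomain R] in
theorem two_le_card [Finite (R ⧸ v.asIdeal)] : 2 ≤ Nat.card (R ⧸ v.asIdeal) := by
  have : Nontrivial (R ⧸ v.asIdeal) := Ideal.Quotient.nontrivial_iff.2 v.isPrime.ne_top
  exact Finite.one_lt_card

theorem mul_mem_pow_succ_iff {π : R} (hπ : v.intValuation π = exp (-1 : ℤ)) (y : R) (j : ℕ) :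
    π * y ∈ v.asIdeal ^ (j + 1) ↔ y ∈ v.asIdeal ^ j := by
  rw [← intValuation_le_pow_iff_mem, ← intValuation_le_pow_iff_mem, map_mul, hπ,
    show (-((j + 1 : ℕ) : ℤ)) = -1 + -(j : ℤ) by push_cast; ring, exp_add]
  exact mul_le_mul_iff_right₀ (by simp)

/-- With a uniformizer `π` and digits `r` representing the residue field, a residue sequence is
obtained by substituting `π` for `q` in the base-`q` expansion of the index. -/
theorem exists_isResidueSequence [Finite (R ⧸ v.asIdeal)] :
    ∃ a : ℕ → R, v.IsResidueSequence a := by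
  set q := Nat.card (R ⧸ v.asIdeal) with hq
  have hq2 : 2 ≤ q := v.two_le_card
  obtain ⟨π, hπ⟩ := v.intValuation_exists_uniformizer
  have hπP : π ∈ v.asIdeal := by
    simpa using (v.intValuation_le_pow_iff_mem π 1).1 (by simp [hπ])
  obtain ⟨r, hr0, hr⟩ : ∃ r : ℕ → R, r 0 = 0 ∧
      ∀ i < q, ∀ i' < q, r i - r i' ∈ v.asIdeal → i = i' := by
    let e := (Finite.equivFin (R ⧸ v.asIdeal)).symm
    let s : ℕ → R := fun i => if h : i < q then (e ⟨i, h⟩).out else 0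
    refine ⟨fun i => s i - s 0, sub_self _, fun i hi i' hi' h => ?_⟩
    rw [sub_sub_sub_cancel_right, ← Ideal.Quotient.eq] at h
    simp only [s, hi, hi', dif_pos, Ideal.Quotient.mk_out] at h
    simpa using e.injective h
  -- `r 0 = 0` makes the recursion hold at `n = 0` as well, where the list of digits is empty.
  obtain ⟨a, ha⟩ : ∃ a : ℕ → R, ∀ n, a n = r (n % q) + π * a (n / q) := by
    refine ⟨fun n => (Nat.digits q n).foldr (fun d x => r d + π * x) 0, fun n => ?_⟩
    rcases Nat.eq_zero_or_pos n with rfl | hn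
    · simp [hr0]
    · dsimp only
      rw [Nat.digits_def' (by omega) hn, List.foldr_cons]
  refine ⟨a, fun j => ?_⟩
  induction j with
  | zero => simp [Nat.modEq_one]
  | succ j ih =>
    intro i i'
    rw [Nat.modEq_pow_succ_iff (by omega : 0 < q), ← ih,
      ← v.mul_mem_pow_succ_iff hπ (a (i / q) - a (i' / q)) j]
    have key : a i - a i' = (r (i % q) - r (i' % q)) + π * (a (i / q) - a (i' / q)) := by
      rw [ha i, ha i']; ring
    constructor
    · intro h
      have h1 : i % q = i' % q := by
        refine hr _ (Nat.mod_lt _ (by omega)) _ (Nat.mod_lt _ (by omega)) ?_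
        have h2 : a i - a i' ∈ v.asIdeal :=
          (Ideal.pow_le_self (I := v.asIdeal) (Nat.succ_ne_zero j) : _ ≤ _) h
        rw [key] at h2
        exact (Ideal.add_mem_iff_left _ (Ideal.mul_mem_right _ _ hπP)).1 h2
      refine ⟨h1, ?_⟩
      rwa [key, h1, sub_self, zero_add] at h
    · rintro ⟨h1, h2⟩
      rw [key, show i % q = i' % q from h1, sub_self, zero_add]
      exact h2

variable {v} {a : ℕ → R}

omit [IsDedekindDomain R] in
theorem IsResidueSequence.injective (ha : v.IsResidueSequence a) [Finite (R ⧸ v.asIdeal)] :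
    Function.Injective a := by
  intro i i' h
  have h1 := (ha (max i i') i i').1 (by simp [h])
  have h2 : max i i' < Nat.card (R ⧸ v.asIdeal) ^ max i i' := Nat.lt_pow_self v.two_le_card
  exact h1.eq_of_lt_of_lt (by omega) (by omega)

theorem IsResidueSequence.exists_sub_mem (ha : v.IsResidueSequence a) [Finite (R ⧸ v.asIdeal)]
    (x : R) (j : ℕ) : ∃ r, x - a r ∈ v.asIdeal ^ j := by
  set q := Nat.card (R ⧸ v.asIdeal)
  have hq : 2 ≤ q := v.two_le_card
  have hcard : Nat.card (R ⧸ v.asIdeal ^ j) = q ^ j := cardQuot_pow_of_prime v.ne_bot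
  have : Finite (R ⧸ v.asIdeal ^ j) :=
    Nat.finite_of_card_ne_zero (by rw [hcard]; positivity)
  let φ : Fin (q ^ j) → R ⧸ v.asIdeal ^ j := fun i => Ideal.Quotient.mk _ (a i)
  have hφ : Function.Injective φ := by
    intro i i' h
    have h1 := (ha j i i').1 (Ideal.Quotient.eq.1 h)
    exact Fin.ext (h1.eq_of_lt_of_lt i.2 i'.2)
  have hφ' : Function.Bijective φ :=
    (Nat.bijective_iff_injective_and_card φ).2 ⟨hφ, by simp [hcard]⟩
  obtain ⟨r, hr⟩ := hφ'.2 (Ideal.Quotient.mk _ x)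
  exact ⟨r, Ideal.Quotient.eq.1 hr.symm⟩

open Classical in
/-- The exponents `k ∈ {1, …, N}` with `y ∈ v ^ k` form an initial segment, so their number bounds
the multiplicity of `v` in `y` from below. This also holds for `y = 0`. -/
theorem intValuation_le_card_filter (y : R) (N : ℕ) :
    v.intValuation y ≤
      exp (-(((Finset.range N).filter fun j => y ∈ v.asIdeal ^ (j + 1)).card : ℤ)) := by
  rw [intValuation_le_pow_iff_mem]
  induction N with
  | zero => simp
  | succ N ih =>
    rw [Finset.range_add_one, Finset.filter_insert]
    split_ifs with h
    · refine Ideal.pow_le_pow_right ?_ h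
      refine (Finset.card_insert_le _ _).trans ?_
      grw [Finset.card_filter_le]
      simp
    · exact ih

open Classical in
theorem card_filter_le_intValuation {y : R} {N : ℕ} (h : y ∉ v.asIdeal ^ (N + 1)) :
    exp (-(((Finset.range N).filter fun j => y ∈ v.asIdeal ^ (j + 1)).card : ℤ)) ≤
      v.intValuation y := by
  set s := (Finset.range N).filter fun j => y ∈ v.asIdeal ^ (j + 1) with hs
  by_contra! hlt
  have hmem : y ∈ v.asIdeal ^ (s.card + 1) := by
    rw [← intValuation_le_pow_iff_mem]
    rw [show (-((s.card + 1 : ℕ) : ℤ)) = -(s.card : ℤ) + -1 by push_cast; ring, exp_add,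
      ← lt_mul_exp_iff_le (by simp), ← exp_add, ← exp_add]
    simpa using hlt
  have hsub : Finset.range (s.card + 1) ⊆ s := by
    intro j hj
    have hj' : j ≤ s.card := by simpa [Nat.lt_succ_iff] using hj
    have hy : y ∈ v.asIdeal ^ (j + 1) := Ideal.pow_le_pow_right (by omega) hmem
    refine Finset.mem_filter.2 ⟨?_, hy⟩
    by_contra hjN
    refine h (Ideal.pow_le_pow_right ?_ hy)
    simp at hjN
    omega
  have := Finset.card_le_card hsub
  simp at this

/-- Every block of `q ^ (j + 1)` consecutive indices contains one `i` with `x ≡ a i` modulo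
`v ^ (j + 1)`, so there are at least `⌊n / q ^ (j + 1)⌋` such `i < n`; summing over `j` gives
`wSum q n`. -/
theorem IsResidueSequence.prod_sub_mem (ha : v.IsResidueSequence a) [Finite (R ⧸ v.asIdeal)]
    (x : R) (n : ℕ) :
    ∏ i ∈ Finset.range n, (x - a i) ∈ v.asIdeal ^ wSum (Nat.card (R ⧸ v.asIdeal)) n := by
  classical
  set q := Nat.card (R ⧸ v.asIdeal)
  have hq : 2 ≤ q := v.two_le_card
  rw [← intValuation_le_pow_iff_mem, map_prod]
  refine (Finset.prod_le_prod' fun i _ => v.intValuation_le_card_filter (x - a i) n).trans ?_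
  rw [prod_exp_neg_natCast, exp_le_exp, neg_le_neg_iff, Nat.cast_le, wSum_eq_sum hq le_rfl]
  simp only [Finset.card_filter]
  rw [Finset.sum_comm]
  refine Finset.sum_le_sum fun j _ => ?_
  obtain ⟨r, hr⟩ := ha.exists_sub_mem x (j + 1)
  rw [← Finset.card_filter]
  have h := Nat.count_modEq_card n (show 0 < q ^ (j + 1) by positivity) r
  rw [Nat.count_eq_card_filter_range] at h
  refine le_trans (by rw [h]; exact Nat.le_add_right _ _) (Finset.card_le_card ?_)
  refine Finset.monotone_filter_right _ fun i _ hi => ?_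
  rw [show x - a i = (x - a r) - (a i - a r) by ring]
  exact sub_mem hr ((ha _ _ _).2 hi)

/-- The denominators of Lagrange interpolation at `a 0, …, a n` are divisible by `v` at most
`wSum q n` times. -/
theorem IsResidueSequence.le_intValuation_prod_sub (ha : v.IsResidueSequence a)
    [Finite (R ⧸ v.asIdeal)] {n i : ℕ} (hi : i ∈ Finset.range (n + 1)) :
    exp (-(wSum (Nat.card (R ⧸ v.asIdeal)) n : ℤ)) ≤
      v.intValuation (∏ j ∈ (Finset.range (n + 1)).erase i, (a i - a j)) := by
  classical
  set q := Nat.card (R ⧸ v.asIdeal)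
  have hq : 2 ≤ q := v.two_le_card
  have hi' : i ≤ n := by simpa [Nat.lt_succ_iff] using hi
  rw [map_prod]
  refine le_trans ?_ (Finset.prod_le_prod' fun j hj =>
    v.card_filter_le_intValuation (y := a i - a j) (N := n) fun hmem => ?_)
  · rw [prod_exp_neg_natCast, exp_le_exp, neg_le_neg_iff, Nat.cast_le, wSum_eq_sum hq le_rfl]
    simp only [Finset.card_filter]
    rw [Finset.sum_comm]
    refine Finset.sum_le_sum fun k _ => ?_
    rw [← Finset.card_filter]
    -- Among the `n + 1` indices at most `⌊n / q ^ (k + 1)⌋ + 1` are congruent to `i`,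
    -- and `i` is one of them.
    have h' : (((Finset.range (n + 1)).filter (· ≡ i [MOD q ^ (k + 1)])).erase i).card ≤
        n / q ^ (k + 1) := by
      rw [Finset.card_erase_of_mem (by simpa [Nat.ModEq.refl] using hi),
        ← Nat.count_eq_card_filter_range,
        Nat.count_modEq_card _ (by positivity), Nat.succ_div]
      generalize n / q ^ (k + 1) = d
      split_ifs with h1 h2
      · rw [Nat.dvd_iff_mod_eq_zero.1 h1] at h2
        exact absurd h2 (Nat.not_lt_zero _)
      all_goals omega
    refine le_trans (Finset.card_le_card fun j hj => ?_) h'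
    simp only [Finset.mem_filter, Finset.mem_erase] at hj ⊢
    exact ⟨hj.1.1, hj.1.2, ((ha _ _ _).1 hj.2).symm⟩
  · have hj' := Finset.mem_erase.1 hj
    have h1 := (ha _ _ _).1 hmem
    have h2 : n + 1 < Nat.card (R ⧸ v.asIdeal) ^ (n + 1) := Nat.lt_pow_self hq
    have h3 := Finset.mem_range.1 hj'.2
    exact hj'.1 (h1.eq_of_lt_of_lt (by omega) (by omega)).symm

end IsDedekindDomain.HeightOneSpectrum

/-! ### Galois traces prime to a tamely ramified prime -/

section Galois

open scoped Pointwise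

variable {S : Type*} [CommRing S] {G : Type*} [Group G] [MulSemiringAction G S]

open Classical in
/-- Modulo `P`, the elements of the decomposition group give multiplicative characters `S →* S ⧸ P`,
each character occurring as often as the order of the inertia group. If that order is nonzero in
`S ⧸ P`, Dedekind's independence of characters forbids their sum to vanish. -/
theorem exists_sum_stabilizer_smul_notMem [Fintype G] (P : Ideal S) [P.IsPrime]
    (hP : (Nat.card (P.inertia G) : S) ∉ P) :
    ∃ d : S, ∑ σ : G with σ • P = P, σ • d ∉ P := by
  by_contra! hall
  let φ : G → S →* S ⧸ P := fun σ =>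
    ((Ideal.Quotient.mk P).comp (MulSemiringAction.toRingHom G S σ)).toMonoidHom
  let s : Finset G := Finset.univ.filter fun σ => σ • P = P
  have hφ : ∀ σ τ : G, φ τ = φ σ ↔ ∀ x, τ • x - σ • x ∈ P := fun σ τ => by
    simp only [MonoidHom.ext_iff]
    exact forall_congr' fun x => Ideal.Quotient.eq
  have hfib : ∀ σ ∈ s, (s.filter fun τ => φ τ = φ σ).card = Nat.card (P.inertia G) := by
    intro σ hσ
    have hσ' : σ • P = P := (Finset.mem_filter.1 hσ).2
    rw [Nat.card_eq_fintype_card, ← Finset.card_univ]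
    symm
    refine Finset.card_bij (fun (ρ : P.inertia G) _ => σ * (ρ : G)) ?_ ?_ ?_
    · intro ρ _
      have hρ : (ρ : G) • P = P := Ideal.inertia_le_stabilizer P ρ.2
      refine Finset.mem_filter.2 ⟨Finset.mem_filter.2 ⟨Finset.mem_univ _, ?_⟩, (hφ _ _).2 ?_⟩
      · rw [mul_smul, hρ, hσ']
      · intro x
        rw [mul_smul, ← smul_sub]
        have h1 := Ideal.smul_mem_pointwise_smul σ _ P (ρ.2 x)
        rwa [hσ'] at h1
    · intro ρ _ ρ' _ h
      exact Subtype.ext (mul_left_cancel h)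
    · intro τ hτ
      have hτ' := (hφ _ _).1 (Finset.mem_filter.1 hτ).2
      refine ⟨⟨σ⁻¹ * τ, fun x => ?_⟩, Finset.mem_univ _, by simp⟩
      change (σ⁻¹ * τ) • x - x ∈ P
      rw [← Ideal.smul_mem_pointwise_smul_iff (a := σ), hσ', smul_sub, mul_smul, smul_inv_smul]
      exact hτ' x
  -- Grouping equal characters, the vanishing sum becomes a linear relation between distinct ones.
  have hzero : ∑ ψ ∈ s.image φ, (Nat.card (P.inertia G) : S ⧸ P) • (ψ : S → S ⧸ P) = 0 := by
    funext d
    have h1 : ∑ σ ∈ s, φ σ d = 0 := by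
      have h2 := Ideal.Quotient.eq_zero_iff_mem.2 (hall d)
      rwa [map_sum] at h2
    rw [Finset.sum_apply, Pi.zero_apply, ← h1,
      ← Finset.sum_fiberwise_of_maps_to (t := s.image φ) (g := φ)
        fun σ hσ => Finset.mem_image_of_mem φ hσ]
    refine Finset.sum_congr rfl fun ψ hψ => ?_
    obtain ⟨σ, hσ, rfl⟩ := Finset.mem_image.1 hψ
    rw [Finset.sum_congr rfl fun τ hτ => by rw [(Finset.mem_filter.1 hτ).2],
      Finset.sum_const, hfib σ hσ]
    simp [nsmul_eq_mul]
  have hmem : φ 1 ∈ s.image φ :=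
    Finset.mem_image_of_mem φ (Finset.mem_filter.2 ⟨Finset.mem_univ _, one_smul _ _⟩)
  have h0 := linearIndependent_iff'.1 (linearIndependent_monoidHom S (S ⧸ P)) (s.image φ)
    (fun _ => (Nat.card (P.inertia G) : S ⧸ P)) hzero _ hmem
  refine hP (Ideal.Quotient.eq_zero_iff_mem.1 ?_)
  simpa using h0

/-- An element whose `G`-trace is a unit modulo `P`, and which is divisible by an arbitrary power of
each conjugate of `P` other than `P`. -/
theorem exists_sum_smul_notMem [Fintype G] (P : Ideal S) [hmax : P.IsMaximal]
    (hP : (Nat.card (P.inertia G) : S) ∉ P) (N : ℕ) :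
    ∃ c : S, (∀ σ : G, σ • P ≠ P → c ∈ (σ • P) ^ N) ∧ ∑ σ : G, σ • c ∉ P := by
  classical
  obtain ⟨d, hd⟩ := exists_sum_stabilizer_smul_notMem P hP
  have hmax' : ∀ σ : G, (σ • P).IsMaximal := fun σ => by
    rw [Ideal.pointwise_smul_eq_comap]
    exact Ideal.comap_isMaximal_of_equiv _
  let s : Finset G := Finset.univ.filter fun σ => σ • P ≠ P
  -- The exponent `N + 1` is positive, so that membership in the power implies membership
  -- in `σ • P`.
  have hcop : P ⊔ ⨅ σ ∈ s, (σ • P) ^ (N + 1) = ⊤ := by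
    refine Ideal.sup_iInf_eq_top fun σ hσ => ?_
    have h1 : P ⊔ σ • P = ⊤ :=
      hmax.coprime_of_ne (hmax' σ) (Finset.mem_filter.1 hσ).2.symm
    exact Ideal.sup_pow_eq_top h1
  obtain ⟨y, hy, c, hc, hyc⟩ := Submodule.mem_sup.1 (hcop ▸ Submodule.mem_top : d ∈ _)
  have hc' : ∀ σ : G, σ • P ≠ P → c ∈ (σ • P) ^ (N + 1) := fun σ hσ =>
    (Submodule.mem_iInf _).1 ((Submodule.mem_iInf _).1 hc σ)
      (Finset.mem_filter.2 ⟨Finset.mem_univ _, hσ⟩)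
  refine ⟨c, fun σ hσ => Ideal.pow_le_pow_right N.le_succ (hc' σ hσ), fun hmem => hd ?_⟩
  rw [← Finset.sum_filter_add_sum_filter_not Finset.univ (fun σ : G => σ • P = P)] at hmem
  have hout : ∑ σ : G with ¬ σ • P = P, σ • c ∈ P := by
    refine Ideal.sum_mem _ fun σ hσ => ?_
    have h1 : σ⁻¹ • P ≠ P := fun h => (Finset.mem_filter.1 hσ).2 (inv_smul_eq_iff.1 h).symm
    have h2 := Ideal.pow_le_self (Nat.succ_ne_zero N) (hc' _ h1)
    rwa [Ideal.mem_inv_pointwise_smul_iff] at h2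
  have hin : ∑ σ : G with σ • P = P, σ • c ∈ P := (Ideal.add_mem_iff_left _ hout).1 hmem
  rw [← hyc]
  simp only [smul_add, Finset.sum_add_distrib]
  refine add_mem (Ideal.sum_mem _ fun σ hσ => ?_) hin
  have h3 := (Finset.mem_filter.1 hσ).2
  rw [← h3]
  exact Ideal.smul_mem_pointwise_smul_iff.2 hy

variable {R : Type*} [CommRing R] [Algebra R S]

theorem exists_algebraMap_eq_sum_smul [Fintype G] [Algebra.IsInvariant R S G] (y : S) :
    ∃ t : R, algebraMap R S t = ∑ σ : G, σ • y := by
  refine Algebra.IsInvariant.isInvariant (G := G) _ fun τ => ?_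
  rw [Finset.smul_sum]
  simp only [smul_smul]
  exact Fintype.sum_equiv (Equiv.mulLeft τ) _ _ fun _ => rfl

/-- The `G`-trace, taken coefficientwise, of a polynomial over `S` descends to `R`; its value at `x`
is the sum over `σ` of the `σ`-conjugates of the values at `σ⁻¹ • x`. -/
theorem exists_poly_aeval_eq_sum_smul [Fintype G] [Algebra.IsInvariant R S G] (g : S[X]) :
    ∃ h : R[X], h.degree ≤ g.degree ∧
      (∀ n, algebraMap R S (h.coeff n) = ∑ σ : G, σ • g.coeff n) ∧
      ∀ x : S, aeval x h = ∑ σ : G, σ • g.eval (σ⁻¹ • x) := by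
  classical
  choose t ht using fun y : S => exists_algebraMap_eq_sum_smul (R := R) (G := G) y
  let h : R[X] := ∑ k ∈ g.support, monomial k (t (g.coeff k))
  have hc : ∀ n, algebraMap R S (h.coeff n) = ∑ σ : G, σ • g.coeff n := by
    intro n
    simp only [h, finsetSum_coeff, coeff_monomial]
    rw [Finset.sum_ite_eq']
    split_ifs with hn
    · exact ht _
    · simp [notMem_support_iff.1 hn]
  refine ⟨h, ?_, hc, fun x => ?_⟩
  · refine (degree_sum_le _ _).trans (Finset.sup_le fun k hk => ?_)
    exact (degree_monomial_le _ _).trans (le_degree_of_mem_supp k hk)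
  · simp only [h, map_sum, aeval_monomial, ht, eval_eq_sum, sum_def, Finset.smul_sum,
      smul_mul', smul_pow', smul_inv_smul, Finset.sum_mul]
    exact Finset.sum_comm

end Galois

open IsDedekindDomain WithZero

/-! ### Polynomials with highly divisible values at one prime number -/

section Local

variable {K : Type*} [Field K] [NumberField K] {p : ℕ}

omit [NumberField K] in
theorem liesOver_of_mem (hp : p.Prime) (w : HeightOneSpectrum (𝓞 K))
    (hw : (p : 𝓞 K) ∈ w.asIdeal) : w.asIdeal.LiesOver (Ideal.span {(p : ℤ)}) := by
  have : (Ideal.span {(p : ℤ)}).IsMaximal :=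
    PrincipalIdealRing.isMaximal_of_irreducible (Nat.prime_iff_prime_int.1 hp).irreducible
  refine ⟨this.eq_of_le (Ideal.IsPrime.ne_top inferInstance) ?_⟩
  rw [Ideal.span_singleton_le_iff_mem, Ideal.mem_comap]
  simpa using hw

omit [NumberField K] in
theorem intCast_mem_iff_dvd (hp : p.Prime) (w : HeightOneSpectrum (𝓞 K))
    (hw : (p : 𝓞 K) ∈ w.asIdeal) (m : ℤ) : (m : 𝓞 K) ∈ w.asIdeal ↔ (p : ℤ) ∣ m := by
  have := liesOver_of_mem hp w hw
  rw [← Ideal.mem_span_singleton, Ideal.mem_of_liesOver w.asIdeal (Ideal.span {(p : ℤ)})]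
  simp

variable (K) in
theorem exists_prime_over (hp : p.Prime) :
    ∃ w : HeightOneSpectrum (𝓞 K), (p : 𝓞 K) ∈ w.asIdeal := by
  have hmax : (Ideal.span {(p : ℤ)}).IsMaximal :=
    PrincipalIdealRing.isMaximal_of_irreducible (Nat.prime_iff_prime_int.1 hp).irreducible
  obtain ⟨P, hP, hPp⟩ := Ideal.exists_maximal_ideal_liesOver_of_isIntegral (S := 𝓞 K)
    (Ideal.span {(p : ℤ)})
  have hmem : (p : 𝓞 K) ∈ P := by
    have := (Ideal.mem_of_liesOver P (Ideal.span {(p : ℤ)}) (p : ℤ)).1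
      (Ideal.mem_span_singleton_self _)
    simpa using this
  refine ⟨⟨P, hP.isPrime, ?_⟩, hmem⟩
  rintro rfl
  exact hp.ne_zero (by simpa using hmem)

variable [IsGalois ℚ K]

theorem isPrime_span_natCast (hp : p.Prime) : (Ideal.span {(p : ℤ)}).IsPrime :=
  (Ideal.span_singleton_prime (by exact_mod_cast hp.ne_zero)).2 (Nat.prime_iff_prime_int.1 hp)

theorem natCard_quotient_eq_resCard (hp : p.Prime) (w : HeightOneSpectrum (𝓞 K))
    (hw : (p : 𝓞 K) ∈ w.asIdeal) : Nat.card (𝓞 K ⧸ w.asIdeal) = resCard K p := by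
  have := liesOver_of_mem hp w hw
  have := isPrime_span_natCast hp
  have : (Ideal.span {(p : ℤ)}).IsMaximal :=
    PrincipalIdealRing.isMaximal_of_irreducible (Nat.prime_iff_prime_int.1 hp).irreducible
  have h := Ideal.cardQuot_pow_inertiaDeg (Ideal.span {(p : ℤ)}) w.asIdeal
  rw [resCard, Ideal.inertiaDegIn_eq_inertiaDeg (Ideal.span {(p : ℤ)}) w.asIdeal Gal(K/ℚ),
    ← Submodule.cardQuot_apply, ← h]
  congr 1
  rw [← Ideal.absNorm_apply, Ideal.absNorm_span_singleton]
  simp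

theorem intValuation_natCast_eq (hp : p.Prime) (w : HeightOneSpectrum (𝓞 K))
    (hw : (p : 𝓞 K) ∈ w.asIdeal) : w.intValuation (p : 𝓞 K) = exp (-(ramIdx K p : ℤ)) := by
  have h1 := liesOver_of_mem hp w hw
  have h2 := isPrime_span_natCast hp
  let v : HeightOneSpectrum ℤ := ⟨Ideal.span {(p : ℤ)}, h2, by simp [hp.ne_zero]⟩
  have : w.asIdeal.LiesOver v.asIdeal := h1
  have h := v.intValuation_liesOver w (p : ℤ)
  rw [v.intValuation_singleton (by exact_mod_cast hp.ne_zero) rfl] at h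
  rw [show (p : 𝓞 K) = algebraMap ℤ (𝓞 K) p by simp, ← h,
    Ideal.ramificationIdx'_eq_ramificationIdx v.asIdeal w.asIdeal v.ne_bot, ramIdx,
    Ideal.ramificationIdxIn_eq_ramificationIdx (Ideal.span {(p : ℤ)}) w.asIdeal Gal(K/ℚ),
    ← exp_nsmul]
  simp

theorem le_resCard (hp : p.Prime) : p ≤ resCard K p := by
  have := isPrime_span_natCast hp
  exact Nat.le_self_pow (Ideal.inertiaDegIn_ne_zero Gal(K/ℚ)) p

theorem ramIdx_pos (hp : p.Prime) : 0 < ramIdx K p := by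
  have := isPrime_span_natCast hp
  exact Nat.pos_of_ne_zero (Ideal.ramificationIdxIn_ne_zero Gal(K/ℚ))

theorem natCard_inertia_eq (hp : p.Prime) (w : HeightOneSpectrum (𝓞 K))
    (hw : (p : 𝓞 K) ∈ w.asIdeal) : Nat.card (w.asIdeal.inertia Gal(K/ℚ)) = ramIdx K p := by
  have := isPrime_span_natCast hp
  have := liesOver_of_mem hp w hw
  exact Ideal.card_inertia_eq_ramificationIdxIn (Ideal.span {(p : ℤ)}) w.asIdeal

open scoped Pointwise in
theorem exists_smul_eq (hp : p.Prime) (w w' : HeightOneSpectrum (𝓞 K))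
    (hw : (p : 𝓞 K) ∈ w.asIdeal) (hw' : (p : 𝓞 K) ∈ w'.asIdeal) :
    ∃ σ : Gal(K/ℚ), σ • w.asIdeal = w'.asIdeal := by
  have := liesOver_of_mem hp w hw
  have := liesOver_of_mem hp w' hw'
  exact Ideal.exists_smul_eq_of_isGaloisGroup (Ideal.span {(p : ℤ)}) _ _ _

/-- As `e_p` is the multiplicity in `p` of every prime above `p`, divisibility by `p ^ m` is
divisibility by the `e_p * m`-th power of each of those primes. -/
theorem pow_dvd_of_forall_mem (hp : p.Prime) {z : 𝓞 K} {m : ℕ}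
    (hz : ∀ w : HeightOneSpectrum (𝓞 K), (p : 𝓞 K) ∈ w.asIdeal → z ∈ w.asIdeal ^ (ramIdx K p * m)) :
    (p : 𝓞 K) ^ m ∣ z := by
  have hp0 : (p : 𝓞 K) ≠ 0 := by exact_mod_cast hp.ne_zero
  obtain ⟨y, hy⟩ := HeightOneSpectrum.mem_integers_of_valuation_le_one K
    ((algebraMap (𝓞 K) K z) / (algebraMap (𝓞 K) K (p ^ m))) fun w => by
      rw [map_div₀, HeightOneSpectrum.valuation_of_algebraMap,
        HeightOneSpectrum.valuation_of_algebraMap]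
      refine div_le_one_of_le₀ ?_ zero_le
      by_cases hw : (p : 𝓞 K) ∈ w.asIdeal
      · refine ((w.intValuation_le_pow_iff_mem _ _).2 (hz w hw)).trans_eq ?_
        rw [map_pow, intValuation_natCast_eq hp w hw, ← exp_nsmul]
        congr 1
        push_cast
        simp [mul_comm]
      · rw [map_pow, w.intValuation_eq_one_iff.2 hw, one_pow]
        exact w.intValuation_le_one z
  refine ⟨y, FaithfulSMul.algebraMap_injective (𝓞 K) K ?_⟩
  rw [map_mul, hy, mul_div_cancel₀]
  simp [hp.ne_zero]

open scoped Pointwise in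
/-- The only use of tameness. With `g = ∏_{i < n} (X - a i)` for a residue sequence `a` at one prime
above `p` and `c` of trace prime to `p`, the polynomial is the Galois trace of `c * g`. -/
theorem exists_poly_pow_dvd_aeval (hK : IsTame K) (hp : p.Prime) (n : ℕ) :
    ∃ h : ℤ[X], h.degree ≤ n ∧ ¬ (p : ℤ) ∣ h.coeff n ∧
      ∀ x : 𝓞 K, (p : 𝓞 K) ^ omegaExp K p n ∣ aeval x h := by
  obtain ⟨w, hw⟩ := exists_prime_over K hp
  have hmax := w.isMaximal
  have hfin : Finite (𝓞 K ⧸ w.asIdeal) := Ideal.finiteQuotientOfFreeOfNeBot _ w.ne_bot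
  obtain ⟨a, ha⟩ := w.exists_isResidueSequence
  set W := wSum (resCard K p) n with hW
  obtain ⟨c, hc, hcsum⟩ := exists_sum_smul_notMem (G := Gal(K/ℚ)) w.asIdeal (by
    rw [natCard_inertia_eq hp w hw]
    have h := intCast_mem_iff_dvd hp w hw (ramIdx K p)
    rw [Int.cast_natCast, Int.natCast_dvd_natCast] at h
    exact mt h.1 (hK p hp)) W
  let g : (𝓞 K)[X] := ∏ i ∈ Finset.range n, (X - C (a i))
  have hgm : g.Monic := monic_prod_of_monic _ _ fun i _ => monic_X_sub_C _
  have hgd : g.natDegree = n := by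
    rw [natDegree_prod_of_monic _ _ fun i _ => monic_X_sub_C _]
    simp
  have hgx : ∀ x, g.eval x ∈ w.asIdeal ^ W := fun x => by
    have h := ha.prod_sub_mem x n
    rw [natCard_quotient_eq_resCard hp w hw] at h
    simpa [g, eval_prod] using h
  obtain ⟨h, hdeg, hcoeff, hval⟩ :=
    exists_poly_aeval_eq_sum_smul (R := ℤ) (G := Gal(K/ℚ)) (C c * g)
  refine ⟨h, hdeg.trans ?_, fun hdvd => hcsum ?_, fun x => ?_⟩
  · refine degree_le_of_natDegree_le ((natDegree_C_mul_le _ _).trans hgd.le)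
  · have h1 := hcoeff n
    have h2 : g.coeff n = 1 := by rw [← hgd]; exact hgm.coeff_natDegree
    simp only [coeff_C_mul, h2, mul_one] at h1
    rw [← h1]
    simpa using (intCast_mem_iff_dvd hp w hw _).2 hdvd
  · refine pow_dvd_of_forall_mem hp fun w' hw' => ?_
    rw [hval]
    refine Ideal.sum_mem _ fun σ _ => ?_
    obtain ⟨τ, hτ⟩ := exists_smul_eq hp w w' hw hw'
    refine Ideal.pow_le_pow_right (Nat.mul_div_le W (ramIdx K p)) ?_
    -- The `W`-th power of each conjugate of `w` contains `c * g (σ⁻¹ • x)`: for `w` itself because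
    -- of `g`, for the others because of `c`.
    rw [← hτ, ← smul_pow', Ideal.mem_pointwise_smul_iff_inv_smul_mem, smul_smul,
      eval_mul, eval_C]
    generalize τ⁻¹ * σ = ρ
    rw [← Ideal.mem_inv_pointwise_smul_iff, smul_pow']
    by_cases hρ : ρ⁻¹ • w.asIdeal = w.asIdeal
    · rw [hρ]
      exact Ideal.mul_mem_left _ _ (hgx _)
    · exact Ideal.mul_mem_right _ _ (hc _ hρ)

end Local

/-! ### Common denominators and leading coefficients -/

noncomputable section Global

variable (K : Type*) [Field K] [NumberField K]

/-- The natural number `∏_p p ^ ω_p(n)`. -/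
def commonDenom (n : ℕ) : ℕ := ∏ᶠ p : Nat.Primes, (p : ℕ) ^ omegaExp K p n

variable [IsGalois ℚ K]

theorem omegaExp_mono {p : ℕ} (hp : p.Prime) : Monotone (omegaExp K p) := fun _ _ h =>
  Nat.div_le_div_right (wSum_mono (hp.two_le.trans (le_resCard hp)) h)

theorem omegaExp_eq_zero {p n : ℕ} (hp : p.Prime) (h : n < p) : omegaExp K p n = 0 := by
  have h1 := le_resCard (K := K) hp
  rw [omegaExp, wSum_eq_zero (hp.two_le.trans h1) (h.trans_le h1), Nat.zero_div]

theorem finite_mulSupport_pow_omegaExp (n : ℕ) :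
    (Function.mulSupport fun p : Nat.Primes => (p : ℕ) ^ omegaExp K p n).Finite := by
  refine ((Set.finite_Iic n).preimage (f := fun p : Nat.Primes => (p : ℕ))
    Subtype.val_injective.injOn).subset fun p hp => ?_
  by_contra h
  refine hp ?_
  dsimp only
  rw [omegaExp_eq_zero K p.2 (by simpa using h), pow_zero]

/-- The exact power of `p` in `commonDenom K n` is `p ^ ω_p(n)`. -/
theorem exists_commonDenom_eq_mul {n : ℕ} (p : Nat.Primes) : ∃ D' : ℕ,
    commonDenom K n = (p : ℕ) ^ omegaExp K p n * D' ∧ ¬ (p : ℕ) ∣ D' := by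
  classical
  let s := insert p (finite_mulSupport_pow_omegaExp K n).toFinset
  refine ⟨∏ r ∈ s.erase p, (r : ℕ) ^ omegaExp K r n, ?_, ?_⟩
  · rw [Finset.mul_prod_erase s (fun r : Nat.Primes => (r : ℕ) ^ omegaExp K r n)
      (Finset.mem_insert_self _ _)]
    refine finprod_eq_prod_of_mulSupport_subset _ fun r hr => ?_
    exact Finset.mem_coe.2 (Finset.mem_insert_of_mem ((Set.Finite.mem_toFinset _).2 hr))
  · rw [p.2.prime.dvd_finsetProd_iff]
    rintro ⟨r, hr, hdvd⟩
    have h1 := (Nat.prime_dvd_prime_iff_eq p.2 r.2).1 (p.2.dvd_of_dvd_pow hdvd)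
    exact (Finset.mem_erase.1 hr).1 (Subtype.ext h1.symm)

theorem pow_omegaExp_dvd_commonDenom {p : ℕ} (hp : p.Prime) (n : ℕ) :
    p ^ omegaExp K p n ∣ commonDenom K n := by
  obtain ⟨D', h, -⟩ := exists_commonDenom_eq_mul K (n := n) ⟨p, hp⟩
  exact ⟨D', h⟩

omit [IsGalois ℚ K] in
theorem commonDenom_pos (n : ℕ) : 0 < commonDenom K n :=
  finprod_induction (0 < ·) one_pos (fun _ _ => Nat.mul_pos) fun p => pow_pos p.2.pos _

theorem commonDenom_dvd {m n : ℕ} (h : m ≤ n) : commonDenom K m ∣ commonDenom K n := by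
  classical
  let s := (finite_mulSupport_pow_omegaExp K m).toFinset ∪
    (finite_mulSupport_pow_omegaExp K n).toFinset
  rw [commonDenom, commonDenom, finprod_eq_prod_of_mulSupport_subset (s := s) _ (by simp [s]),
    finprod_eq_prod_of_mulSupport_subset (s := s) _ (by simp [s])]
  exact Finset.prod_dvd_prod_of_dvd _ _ fun p _ => pow_dvd_pow _ (omegaExp_mono K p.2 h)

omit [IsGalois ℚ K] in
theorem finprod_pow_omegaExp (n : ℕ) :
    ∏ᶠ p : Nat.Primes, ((p : ℕ) : ℚ) ^ omegaExp K p n = commonDenom K n := by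
  simp [commonDenom]

omit [IsGalois ℚ K] in
theorem finprod_zpow_neg_omegaExp (n : ℕ) :
    ∏ᶠ p : Nat.Primes, ((p : ℕ) : ℚ) ^ (-(omegaExp K p n : ℤ)) = (commonDenom K n : ℚ)⁻¹ := by
  rw [← finprod_pow_omegaExp, ← finprod_inv_distrib]
  simp

variable {K}

/-- The coefficients of `X ^ n` in the integral polynomials of degree at most `n` whose values on
`𝓞 K` are divisible by `commonDenom K n` form an ideal of `ℤ`. The local constructions show that no prime
number divides all of them, so this ideal is `ℤ`. -/
theorem exists_monic_forall_dvd_aeval (hK : IsTame K) (n : ℕ) :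
    ∃ g : ℤ[X], g.Monic ∧ g.natDegree = n ∧
      ∀ x : 𝓞 K, (commonDenom K n : 𝓞 K) ∣ aeval x g := by
  let M : Submodule ℤ ℤ[X] :=
    { carrier := {h | h.degree ≤ n ∧ ∀ x : 𝓞 K, (commonDenom K n : 𝓞 K) ∣ aeval x h}
      add_mem' := fun {f g} hf hg =>
        ⟨degree_add_le_of_degree_le hf.1 hg.1, fun x => by
          rw [map_add]; exact dvd_add (hf.2 x) (hg.2 x)⟩
      zero_mem' := ⟨by simp, fun x => by simp⟩
      smul_mem' := fun m f hf =>
        ⟨(degree_smul_le m f).trans hf.1, fun x => by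
          rw [map_zsmul, zsmul_eq_mul]; exact (hf.2 x).mul_left _⟩ }
  let J : Ideal ℤ := M.map (lcoeff ℤ n)
  have hJ : J = ⊤ := by
    obtain ⟨d, hd⟩ := IsPrincipalIdealRing.principal J
    rw [hd, Ideal.submodule_span_eq, Ideal.span_singleton_eq_top, Int.isUnit_iff_natAbs_eq]
    by_contra hne
    obtain ⟨p, hp, hpd⟩ := Nat.exists_prime_and_dvd hne
    obtain ⟨h, hdeg, hcoeff, hval⟩ := exists_poly_pow_dvd_aeval hK hp n
    obtain ⟨D', hD', hpD'⟩ := exists_commonDenom_eq_mul K (n := n) ⟨p, hp⟩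
    have hmem : (D' : ℤ) * h.coeff n ∈ J := by
      refine ⟨(D' : ℤ) • h, ⟨(degree_smul_le _ _).trans hdeg, fun x => ?_⟩, by simp⟩
      rw [map_zsmul, zsmul_eq_mul, hD', Nat.cast_mul, Nat.cast_pow, Int.cast_natCast, mul_comm]
      exact mul_dvd_mul_left _ (hval x)
    rw [hd, Ideal.submodule_span_eq, Ideal.mem_span_singleton] at hmem
    rcases (Nat.prime_iff_prime_int.1 hp).dvd_or_dvd ((Int.natCast_dvd.2 hpd).trans hmem)
      with h1 | h1
    · exact hpD' (Int.natCast_dvd_natCast.1 h1)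
    · exact hcoeff h1
  obtain ⟨g, ⟨hgd, hgx⟩, hg1⟩ := (hJ ▸ Submodule.mem_top : (1 : ℤ) ∈ J)
  have hgn : g.coeff n = 1 := hg1
  have hdeg : g.natDegree = n :=
    le_antisymm (natDegree_le_of_degree_le hgd) (le_natDegree_of_ne_zero (by simp [hgn]))
  exact ⟨g, by rw [Monic, leadingCoeff, hdeg, hgn], hdeg, hgx⟩

/-- Lagrange interpolation at `n + 1` terms of a residue sequence writes the leading coefficient as
a sum of fractions with integral numerators and controlled denominators. -/
theorem valuation_leadingCoeff_le {p : ℕ} (hp : p.Prime) (w : HeightOneSpectrum (𝓞 K))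
    (hw : (p : 𝓞 K) ∈ w.asIdeal) {f : ℚ[X]} (hf : f ∈ IntQ K) {n : ℕ} (hn : f.degree = n) :
    w.valuation K (algebraMap ℚ K f.leadingCoeff) ≤ exp (wSum (resCard K p) n : ℤ) := by
  have hfin : Finite (𝓞 K ⧸ w.asIdeal) := Ideal.finiteQuotientOfFreeOfNeBot _ w.ne_bot
  obtain ⟨a, ha⟩ := w.exists_isResidueSequence
  have hinj : Function.Injective fun i => (a i : K) :=
    (FaithfulSMul.algebraMap_injective (𝓞 K) K).comp ha.injective
  have hlc := Lagrange.leadingCoeff_eq_sum (s := Finset.range (n + 1)) (v := fun i => (a i : K))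
    hinj.injOn (P := f.map (algebraMap ℚ K)) (by simp [hn])
  rw [leadingCoeff_map] at hlc
  rw [hlc]
  refine Valuation.map_sum_le _ fun i hi => ?_
  obtain ⟨b, hb⟩ := hf (a i)
  have hprod : ∏ j ∈ (Finset.range (n + 1)).erase i, ((a i : K) - (a j : K)) =
      algebraMap (𝓞 K) K (∏ j ∈ (Finset.range (n + 1)).erase i, (a i - a j)) := by
    simp [map_prod]
  rw [hprod, eval_map_algebraMap, hb, map_div₀, HeightOneSpectrum.valuation_of_algebraMap,
    HeightOneSpectrum.valuation_of_algebraMap]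
  have h1 := ha.le_intValuation_prod_sub hi
  rw [natCard_quotient_eq_resCard hp w hw] at h1
  refine (div_le_div₀ zero_le_one (w.intValuation_le_one b) (by simp) h1).trans_eq ?_
  rw [one_div, ← exp_neg, neg_neg]

theorem den_leadingCoeff_dvd {f : ℚ[X]} (hf : f ∈ IntQ K) {n : ℕ} (hn : f.degree = n) :
    f.leadingCoeff.den ∣ commonDenom K n := by
  rw [Nat.dvd_iff_prime_pow_dvd_dvd]
  intro p k hp hk
  refine (pow_dvd_pow p ?_).trans (pow_omegaExp_dvd_commonDenom K hp n)
  rcases Nat.eq_zero_or_pos k with rfl | hkpos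
  · exact Nat.zero_le _
  obtain ⟨w, hw⟩ := exists_prime_over K hp
  have hle := valuation_leadingCoeff_le hp w hw hf hn
  set r := f.leadingCoeff
  have hnum : ¬ (p : ℤ) ∣ r.num := fun h => by
    have h1 : p ∣ r.den := (dvd_pow_self p hkpos.ne').trans hk
    exact hp.one_lt.ne' (Nat.dvd_one.1 (r.reduced ▸ Nat.dvd_gcd (Int.natCast_dvd.1 h) h1))
  obtain ⟨d, hd⟩ := hk
  have hr : algebraMap ℚ K r * algebraMap (𝓞 K) K ((p : 𝓞 K) ^ k * (d : 𝓞 K)) =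
      algebraMap (𝓞 K) K (r.num : 𝓞 K) := by
    have h1 : r * (r.den : ℚ) = r.num := Rat.mul_den_eq_num r
    have h2 := congrArg (algebraMap ℚ K) h1
    rw [hd] at h2
    simpa using h2
  have hv := congrArg (w.valuation K) hr
  rw [map_mul, HeightOneSpectrum.valuation_of_algebraMap,
    HeightOneSpectrum.valuation_of_algebraMap,
    w.intValuation_eq_one_iff.2 (mt (intCast_mem_iff_dvd hp w hw _).1 hnum),
    map_mul, map_pow, intValuation_natCast_eq hp w hw] at hv
  have h2 : (1 : ℤᵐ⁰) ≤ exp (wSum (resCard K p) n : ℤ) * exp (-(ramIdx K p : ℤ)) ^ k := by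
    rw [← hv]
    exact mul_le_mul' hle (mul_le_of_le_one_right' (w.intValuation_le_one _))
  rw [← exp_nsmul, ← exp_add, ← exp_zero, exp_le_exp] at h2
  rw [omegaExp, Nat.le_div_iff_mul_le (ramIdx_pos hp)]
  zify
  simp at h2
  linarith

end Global

/-! ### Characteristic ideals and regular bases -/

section Basis

variable {K : Type*} [Field K] [NumberField K]

theorem C_inv_mul_map_mem_IntQ {D : ℕ} (hD : 0 < D) {g : ℤ[X]}
    (hg : ∀ x : 𝓞 K, (D : 𝓞 K) ∣ aeval x g) :
    C (D : ℚ)⁻¹ * g.map (Int.castRingHom ℚ) ∈ IntQ K := by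
  intro x
  obtain ⟨b, hb⟩ := hg x
  refine ⟨b, ?_⟩
  have h1 : aeval (x : K) (g.map (Int.castRingHom ℚ)) = (D : K) * (b : K) := by
    rw [← algebraMap_int_eq, aeval_map_algebraMap]
    have h2 := aeval_algebraMap_apply K x g
    rw [hb] at h2
    simpa using h2
  rw [map_mul, aeval_C, h1, map_inv₀, map_natCast, inv_mul_cancel_left₀]
  exact_mod_cast hD.ne'

/-- If the `k`-th spanning polynomial has degree `k` for every `k`, the leading coefficient of an
integral combination of degree `n` is contributed by the `n`-th polynomial alone. -/
theorem leadingCoeff_eq_mul_of_mem_span {f : ℕ → ℚ[X]}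
    (hf : ∀ k : ℕ, (f k).degree = (k : WithBot ℕ))
    {h : ℚ[X]} (hh : h ∈ Submodule.span ℤ (Set.range f)) {n : ℕ} (hn : h.degree = n) :
    ∃ c : ℤ, h.leadingCoeff = c * (f n).leadingCoeff := by
  obtain ⟨c, rfl⟩ := (Finsupp.mem_span_range_iff_exists_finsupp).1 hh
  have hc : c.support.Nonempty := by
    rw [Finsupp.support_nonempty_iff]
    rintro rfl
    simp at hn
  set N := c.support.max' hc with hN
  have hcoeff : ∀ k, N ≤ k →
      (c.sum fun i a => a • f i).coeff k = c k * (f k).leadingCoeff := by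
    intro k hk
    rw [Finsupp.sum, finsetSum_coeff, Finset.sum_eq_single k]
    · rw [coeff_smul, zsmul_eq_mul, leadingCoeff, natDegree_eq_of_degree_eq_some (hf k)]
    · intro i hi hik
      have hiN : i ≤ N := Finset.le_max' _ _ hi
      rw [coeff_smul, coeff_eq_zero_of_degree_lt, smul_zero]
      rw [hf i]
      exact_mod_cast lt_of_le_of_ne (hiN.trans hk) hik
    · intro hk'
      simp [Finsupp.notMem_support_iff.1 hk']
  have hfN : (f N).leadingCoeff ≠ 0 := by
    rw [leadingCoeff_ne_zero]
    intro h0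
    have := hf N
    simp [h0] at this
  have hcN : c N ≠ 0 := Finsupp.mem_support_iff.1 (Finset.max'_mem _ hc)
  have hdeg : (c.sum fun i a => a • f i).natDegree = N := by
    refine natDegree_eq_of_le_of_coeff_ne_zero (natDegree_le_iff_coeff_eq_zero.2 fun k hk => ?_) ?_
    · rw [hcoeff k hk.le]
      have : c k = 0 := by
        by_contra h0
        exact hk.not_ge (Finset.le_max' _ _ (Finsupp.mem_support_iff.2 h0))
      simp [this]
    · rw [hcoeff N le_rfl]
      exact mul_ne_zero (by exact_mod_cast hcN) hfN
  have hNn : N = n := hdeg.symm.trans (natDegree_eq_of_degree_eq_some hn)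
  refine ⟨c n, ?_⟩
  rw [leadingCoeff, hdeg, hcoeff N le_rfl, hNn]

variable [IsGalois ℚ K]

theorem exists_int_leadingCoeff {f : ℚ[X]} (hf : f ∈ IntQ K) {n : ℕ} (hn : f.degree = n) :
    ∃ m : ℤ, f.leadingCoeff = m * (commonDenom K n : ℚ)⁻¹ := by
  obtain ⟨d, hd⟩ := den_leadingCoeff_dvd hf hn
  have hpos : (commonDenom K n : ℚ) ≠ 0 := by exact_mod_cast (commonDenom_pos K n).ne'
  refine ⟨f.leadingCoeff.num * d, ?_⟩
  rw [eq_mul_inv_iff_mul_eq₀ hpos, hd, Nat.cast_mul, ← mul_assoc, Rat.mul_den_eq_num]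
  push_cast
  rfl

theorem exists_IntQ_monic (hK : IsTame K) (n : ℕ) :
    ∃ g : ℤ[X], g.Monic ∧ g.natDegree = n ∧
      C (commonDenom K n : ℚ)⁻¹ * g.map (Int.castRingHom ℚ) ∈ IntQ K := by
  obtain ⟨g, hg, hgn, hgx⟩ := exists_monic_forall_dvd_aeval hK n
  exact ⟨g, hg, hgn, C_inv_mul_map_mem_IntQ (commonDenom_pos K n) hgx⟩

/-- Every element of `IntQ K` of degree at most `n` becomes integral after multiplication by
`commonDenom K n`. By induction on the degree, subtracting a multiple of the element
`g / commonDenom` of the same degree; the separate bound `d ≤ n + 1` lets `n` stay fixed while the degree drops. -/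
theorem exists_map_eq_commonDenom_mul (hK : IsTame K) (d : ℕ) : ∀ n : ℕ, d ≤ n + 1 →
    ∀ f ∈ IntQ K, f.degree < d →
      ∃ G : ℤ[X], G.map (Int.castRingHom ℚ) = C (commonDenom K n : ℚ) * f := by
  induction d with
  | zero =>
    intro n _ f _ hdeg
    have : f = 0 := degree_eq_bot.1 (Nat.WithBot.lt_zero_iff.1 (by simpa using hdeg))
    exact ⟨0, by simp [this]⟩
  | succ d ih =>
    intro n hn f hf hdeg
    by_cases hlt : f.degree < d
    · exact ih n (by omega) f hf hlt
    have hfd : f.degree = d := le_antisymm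
      ((degree_le_iff_coeff_zero _ _).2 fun k hk =>
        (degree_lt_iff_coeff_zero _ _).1 hdeg k (by exact_mod_cast hk)) (not_lt.1 hlt)
    obtain ⟨m, hm⟩ := exists_int_leadingCoeff hf hfd
    obtain ⟨g, hg, hgd, hgI⟩ := exists_IntQ_monic hK d
    set φ : ℚ[X] := C (commonDenom K d : ℚ)⁻¹ * g.map (Int.castRingHom ℚ) with hφ
    have hgmap : (g.map (Int.castRingHom ℚ)).natDegree = d := by
      rw [hg.natDegree_map, hgd]
    obtain ⟨G, hG⟩ := ih n (by omega) (f - m • φ)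
      ((IntQ K).sub_mem hf ((IntQ K).smul_mem hgI m)) (by
        rw [degree_lt_iff_coeff_zero]
        intro k hk
        rw [coeff_sub, coeff_smul, hφ, coeff_C_mul]
        rcases hk.eq_or_lt with rfl | hk'
        · have h1 : f.coeff d = f.leadingCoeff := by
            rw [leadingCoeff, natDegree_eq_of_degree_eq_some hfd]
          have h2 : g.coeff d = 1 := by rw [← hgd]; exact hg.coeff_natDegree
          rw [h1, hm, coeff_map, h2]
          simp
        · rw [coeff_eq_zero_of_degree_lt (by rw [hfd]; exact_mod_cast hk'),
            coeff_eq_zero_of_natDegree_lt (by omega)]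
          simp)
    obtain ⟨r, hr⟩ := commonDenom_dvd K (show d ≤ n by omega)
    refine ⟨G + C (m * r : ℤ) * g, ?_⟩
    have hpos : (commonDenom K d : ℚ) ≠ 0 := by exact_mod_cast (commonDenom_pos K d).ne'
    have hrC : C (commonDenom K n : ℚ) * φ = C (r : ℚ) * g.map (Int.castRingHom ℚ) := by
      rw [hφ, ← mul_assoc, ← C_mul, hr, Nat.cast_mul, mul_right_comm, mul_inv_cancel₀ hpos, one_mul]
    rw [Polynomial.map_add, hG, Polynomial.map_mul, map_C, mul_sub, zsmul_eq_mul,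
      mul_left_comm, hrC]
    simp [mul_assoc]

theorem charIdeal_eq_span (hK : IsTame K) (n : ℕ) :
    charIdeal K n = Submodule.span ℤ {(commonDenom K n : ℚ)⁻¹} := by
  refine le_antisymm (Submodule.span_le.2 ?_) (Submodule.span_le.2 ?_)
  · rintro _ ⟨f, hf, hfn, rfl⟩
    obtain ⟨m, hm⟩ := exists_int_leadingCoeff hf hfn
    exact Submodule.mem_span_singleton.2 ⟨m, by rw [hm, zsmul_eq_mul]⟩
  · rw [Set.singleton_subset_iff]
    obtain ⟨g, hg, hgn, hgI⟩ := exists_IntQ_monic hK n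
    have hpos : (commonDenom K n : ℚ) ≠ 0 := by exact_mod_cast (commonDenom_pos K n).ne'
    refine Submodule.subset_span ⟨_, hgI, ?_, ?_⟩
    · rw [degree_C_mul (inv_ne_zero hpos), hg.degree_map, degree_eq_natDegree hg.ne_zero, hgn]
    · rw [leadingCoeff_mul, leadingCoeff_C, (hg.map _).leadingCoeff, mul_one]

theorem IsRegularBasis.exists_monic (hK : IsTame K) {f : ℕ → ℚ[X]} (hf : IsRegularBasis K f)
    (n : ℕ) : ∃ (g : ℤ[X]) (ε : ℤˣ), g.Monic ∧
      f n = C (((ε : ℤ) : ℚ) / commonDenom K n) * g.map (Int.castRingHom ℚ) := by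
  have hpos : (commonDenom K n : ℚ) ≠ 0 := by exact_mod_cast (commonDenom_pos K n).ne'
  have hfI : f n ∈ IntQ K := by
    rw [← Subalgebra.mem_toSubmodule, ← hf.span_eq]
    exact Submodule.subset_span ⟨n, rfl⟩
  obtain ⟨m, hm⟩ := exists_int_leadingCoeff hfI (hf.degree_eq n)
  obtain ⟨g, hg, hgn, hgI⟩ := exists_IntQ_monic hK n
  rw [← Subalgebra.mem_toSubmodule, ← hf.span_eq] at hgI
  obtain ⟨c, hc⟩ := leadingCoeff_eq_mul_of_mem_span hf.degree_eq hgI (n := n) (by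
    rw [degree_C_mul (inv_ne_zero hpos), hg.degree_map, degree_eq_natDegree hg.ne_zero, hgn])
  rw [leadingCoeff_mul, leadingCoeff_C, (hg.map _).leadingCoeff, mul_one, hm, ← mul_assoc,
    eq_comm, mul_eq_right₀ (inv_ne_zero hpos)] at hc
  have hunit : IsUnit m := IsUnit.of_mul_eq_one_right c (by exact_mod_cast hc)
  obtain ⟨ε, rfl⟩ := hunit
  obtain ⟨G, hG⟩ := exists_map_eq_commonDenom_mul hK (n + 1) n le_rfl (f n) hfI (by
    rw [hf.degree_eq n]; exact_mod_cast n.lt_succ_self)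
  have hε : ((ε : ℤ) : ℚ) * ((ε : ℤ) : ℚ) = 1 := by
    exact_mod_cast Int.units_coe_mul_self ε
  have hmap : (C (ε : ℤ) * G).map (Int.castRingHom ℚ) =
      C (((ε : ℤ) : ℚ) * commonDenom K n) * f n := by
    rw [Polynomial.map_mul, hG, map_C, ← mul_assoc, ← C_mul]
    rfl
  refine ⟨C (ε : ℤ) * G, ε, ?_, ?_⟩
  · refine monic_of_injective (Int.castRingHom ℚ).injective_int ?_
    rw [hmap, Monic, leadingCoeff_mul, leadingCoeff_C, hm]
    field_simp
    linear_combination hε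
  · rw [hmap, ← mul_assoc, ← C_mul, div_mul_eq_mul_div, ← mul_assoc, hε, one_mul, div_self hpos,
      C_1, one_mul]

end Basis

theorem theorem3p6 (K : Type*) [Field K] [NumberField K] [IsGalois ℚ K] (hK : IsTame K) :
    (∀ n : ℕ, charIdeal K n =
      ((FractionalIdeal.spanSingleton ℤ⁰
        (∏ᶠ p : Nat.Primes, ((p : ℕ) : ℚ) ^ (-(omegaExp K p n : ℤ))) :
          FractionalIdeal ℤ⁰ ℚ) : Submodule ℤ ℚ)) ∧
    (∀ f : ℕ → ℚ[X], IsRegularBasis K f →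
      ∀ n : ℕ, ∃ (g : ℤ[X]) (ε : ℤˣ), g.Monic ∧
        f n = C ((((ε : ℤ) : ℚ)) / ∏ᶠ p : Nat.Primes, ((p : ℕ) : ℚ) ^ omegaExp K p n) *
          g.map (Int.castRingHom ℚ)) := by
  refine ⟨fun n => ?_, fun f hf n => ?_⟩
  · rw [finprod_zpow_neg_omegaExp, FractionalIdeal.coe_spanSingleton, charIdeal_eq_span hK]
  · rw [finprod_pow_omegaExp]
    exact hf.exists_monic hK n
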